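/- Let $dA(w)=d^2w/\pi$ be normalized area measure on $\mathbb C$, let $\partial=\frac12(\partial_x-i\partial_y)$, $\bar\partial=\frac12(\partial_x+i\partial_y)$, and let $\Delta=\partial\bar\partial$ (one quarter of the usual Laplacian). Let $\mathbb L=\{z\in\mathbb C:\operatorname{Re}z<0\}$ and put $$G(z,w)=e^{z\bar w-|z|^2/2-|w|^2/2},\qquad F(t)=\tfrac12\operatorname{erfc}\Big(\frac{t}{\sqrt2}\Big),\qquad H(z)=\frac1{\sqrt{2\pi}}\int_{-\infty}^0\frac{e^{-(z-t)^2/2}}{F(t)}\,dt ,$$ where $\operatorname{erfc}(x)=\frac{2}{\sqrt\pi}\int_x^\infty e^{-s^2}\,ds$. Let $K$ be the hard edge plasma kernel $$K(z,w)=G(z,w)\,H(z+\bar w)\,\mathbf 1_{\mathbb L}(z)\,\mathbf 1_{\mathbb L}(w),$$ and put $$R(z)=K(z,z),\qquad B(z,w)=\frac{|K(z,w)|^2}{K(z,z)},\qquad C(z)=\int_{\mathbb L}\frac{B(z,w)}{z-w}\,dA(w)\qquad(z\in\mathbb L).$$ Then $R$ is real-valued, strictly positive and $C^\infty$ on $\mathbb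 L$; for every $z\in\mathbb L$ the integral defining $C(z)$ converges absolutely; $C$ is $C^\infty$ (in the real sense) on $\mathbb L$; and the hard edge Ward equation holds pointwise: $$\bar\partial C(z)=R(z)-1-\Delta\log R(z),\qquad z\in\mathbb L .$$ -/

import Mathlib

open MeasureTheory Set
open scoped ContDiff

noncomputable section

namespace HardEdge

/-- The complementary error function `erfc x = (2/√π) ∫_x^∞ exp(-s²) ds` on the real line. -/
def erfc (x : ℝ) : ℝ := 2 / √Real.pi * ∫ s in Ioi x, Real.exp (-s ^ 2)

/-- The free boundary plasma function `F(t) = (1/2) erfc(t/√2)`, on the real line. -/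
def plasmaF (t : ℝ) : ℝ := 1 / 2 * erfc (t / √2)

/-- The hard edge plasma function
`H(z) = (1/√(2π)) ∫_{-∞}^0 exp(-(z-t)²/2) / F(t) dt`, for complex `z`. -/
def plasmaH (z : ℂ) : ℂ :=
  1 / ((√(2 * Real.pi) : ℝ) : ℂ) *
    ∫ t in Iio (0 : ℝ), Complex.exp (-(z - (t : ℂ)) ^ 2 / 2) / ((plasmaF t : ℝ) : ℂ)

/-- The Ginibre kernel `G(z,w) = exp(z w̄ - |z|²/2 - |w|²/2)`. -/
def ginibreKernel (z w : ℂ) : ℂ :=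
  Complex.exp (z * (starRingEnd ℂ) w - ((‖z‖ ^ 2 / 2 : ℝ) : ℂ) - ((‖w‖ ^ 2 / 2 : ℝ) : ℂ))

/-- The open left half-plane `𝕃 = {z : Re z < 0}`. -/
def leftHalfPlane : Set ℂ := {z | z.re < 0}

/-- The hard edge plasma kernel `K(z,w) = G(z,w) H(z + w̄) 1_𝕃(z) 1_𝕃(w)`. -/
def kernel (z w : ℂ) : ℂ :=
  ginibreKernel z w * plasmaH (z + (starRingEnd ℂ) w) *
    leftHalfPlane.indicator 1 z * leftHalfPlane.indicator 1 w

/-- The one-point function `R(z) = K(z,z)`, as a real number. The real part discards nothing on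
`𝕃`: the main theorem also asserts `K(z,z) = R(z)` there. -/
def onePoint (z : ℂ) : ℝ := (kernel z z).re

/-- The Berezin kernel `B(z,w) = |K(z,w)|² / K(z,z)`. -/
def berezin (z w : ℂ) : ℝ := ‖kernel z w‖ ^ 2 / onePoint z

/-- The normalized area measure `dA = d²w / π` on `ℂ`. -/
def area : Measure ℂ := ENNReal.ofReal (1 / Real.pi) • volume

/-- The Cauchy transform `C(z) = ∫_𝕃 B(z,w)/(z-w) dA(w)`, over the left half-plane only. -/
def cauchyTransform (z : ℂ) : ℂ :=
  ∫ w in leftHalfPlane, ((berezin z w : ℝ) : ℂ) / (z - w) ∂area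

/-- The complex derivative `∂ = (1/2)(∂/∂x - i ∂/∂y)`. -/
def del (f : ℂ → ℂ) (z : ℂ) : ℂ :=
  1 / 2 * (fderiv ℝ f z 1 - Complex.I * fderiv ℝ f z Complex.I)

/-- The complex derivative `∂̄ = (1/2)(∂/∂x + i ∂/∂y)`. -/
def delbar (f : ℂ → ℂ) (z : ℂ) : ℂ :=
  1 / 2 * (fderiv ℝ f z 1 + Complex.I * fderiv ℝ f z Complex.I)

/-- The normalized Laplacian `Δ = ∂∂̄`, one quarter of the usual one. -/
def lap (f : ℂ → ℂ) (z : ℂ) : ℂ := del (delbar f) z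

end HardEdge

end

noncomputable section

namespace HardEdge

open Real Filter Topology FourierTransform ComplexConjugate ProbabilityTheory

/-! On `𝕃` everything reduces to one real variable and can be computed. Write z = x + iy, w = u +
iv, and let g_s(t) = exp(-(s-t)²/2)/F(t) on t < 0, with mass m(s) and first moment m₁(s). Completing
the square in `plasmaH` gives |K(z,w)|² = (2π)⁻¹ exp(-(x-u)²) |ĝ_{x+u}((y-v)/2π)|²
(`norm_kernel_sq`), and R(z) = m(2x)/√(2π).

For fixed u ≠ x, the Cauchy kernel is, in v, the Fourier transform of a one-sided exponential, so
Parseval turns the v-integral into a double integral of g_{x+u}(r) g_{x+u}(t) against that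
exponential (`integral_normSq_fourier_cutDensity_div`). The Gaussian exponents then recombine into
g_{2u}(r) g_{2x}(t) (`exp_mul_density_mul_density`). The weight 1/F is chosen so that ∫_{u<0}
g_{2u}(r) du does not depend on r < 0 (`integral_density_two_mul`); integrating over u gives C(z) =
-m₁(2x)/m(2x) - (2/√(2π)) ∫_x^0 m(2u) du (`cauchyTransform_eq`).

Finally m(s) = exp(-s²/2) M(s) and m₁(s) = exp(-s²/2) M'(s), with M a moment generating function.
Since ∂ and ∂̄ act on functions of x as half of d/dx, ∂̄C = R - (log M)''(2x) and Δ log R = (log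
M)''(2x) - 1, which is Ward's equation. -/

lemma integrable_exp_neg_sq_div_two : Integrable fun p : ℝ => exp (-p ^ 2 / 2) := by
  simpa [div_eq_inv_mul, mul_comm, neg_mul] using
    integrable_exp_neg_mul_sq (b := (1 / 2 : ℝ)) (by norm_num)

lemma integral_exp_neg_sq_div_two_Ioi_zero :
    ∫ p in Ioi (0 : ℝ), exp (-p ^ 2 / 2) = √(2 * π) / 2 := by
  have h := integral_gaussian_Ioi (1 / 2)
  have e : ∀ p : ℝ, -p ^ 2 / 2 = -(1 / 2) * p ^ 2 := fun p => by ring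
  simp_rw [e, h]
  congr 2; ring

lemma integral_exp_neg_sq_div_two : ∫ p : ℝ, exp (-p ^ 2 / 2) = √(2 * π) := by
  have h := integral_gaussian (1 / 2)
  have e : ∀ p : ℝ, -p ^ 2 / 2 = -(1 / 2) * p ^ 2 := fun p => by ring
  simp_rw [e, h]
  congr 1; ring

/-! ### The plasma function as a Gaussian tail -/

lemma plasmaF_eq (t : ℝ) :
    plasmaF t = (√(2 * π))⁻¹ * ∫ p in Ioi t, exp (-p ^ 2 / 2) := by
  have h2 : (0 : ℝ) < (√2)⁻¹ := by positivity
  have h := integral_comp_mul_left_Ioi (fun s : ℝ => exp (-s ^ 2)) t h2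
  have e : ∀ p : ℝ, -((√2)⁻¹ * p) ^ 2 = -p ^ 2 / 2 := fun p => by
    rw [mul_pow, inv_pow, Real.sq_sqrt (by norm_num)]; ring
  simp only [e] at h
  rw [h, plasmaF, erfc, sqrt_mul (by norm_num), inv_inv, smul_eq_mul, ← div_eq_inv_mul]
  have : √2 ≠ 0 := by positivity
  have : √π ≠ 0 := by positivity
  field_simp

lemma plasmaF_zero : plasmaF 0 = 1 / 2 := by
  rw [plasmaF_eq, integral_exp_neg_sq_div_two_Ioi_zero]
  have : √(2 * π) ≠ 0 := by positivity
  field_simp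

lemma half_le_plasmaF {t : ℝ} (ht : t ≤ 0) : 1 / 2 ≤ plasmaF t := by
  rw [← plasmaF_zero, plasmaF_eq, plasmaF_eq]
  refine mul_le_mul_of_nonneg_left ?_ (by positivity)
  exact setIntegral_mono_set integrable_exp_neg_sq_div_two.integrableOn
    (ae_of_all _ fun _ => (exp_pos _).le) (Ioi_subset_Ioi ht).eventuallyLE

lemma plasmaF_pos {t : ℝ} (ht : t ≤ 0) : 0 < plasmaF t :=
  lt_of_lt_of_le (by norm_num) (half_le_plasmaF ht)

lemma inv_plasmaF_le {t : ℝ} (ht : t ≤ 0) : (plasmaF t)⁻¹ ≤ 2 := by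
  have := inv_anti₀ (by norm_num) (half_le_plasmaF ht)
  simpa using this

lemma hasDerivAt_plasmaF (t : ℝ) :
    HasDerivAt plasmaF (-((√(2 * π))⁻¹ * exp (-t ^ 2 / 2))) t := by
  have e : plasmaF = fun t => (√(2 * π))⁻¹ *
      ((∫ p in Ioi (0 : ℝ), exp (-p ^ 2 / 2)) - ∫ p in (0 : ℝ)..t, exp (-p ^ 2 / 2)) := by
    ext t
    rw [plasmaF_eq, intervalIntegral.integral_Ioi_sub_Ioi'
      integrable_exp_neg_sq_div_two.integrableOn integrable_exp_neg_sq_div_two.integrableOn |>.symm]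
    ring
  rw [e]
  have hc : Continuous fun p : ℝ => exp (-p ^ 2 / 2) := by fun_prop
  have := (intervalIntegral.integral_hasDerivAt_right (hc.intervalIntegrable 0 t)
    hc.stronglyMeasurable.stronglyMeasurableAtFilter hc.continuousAt)
  simpa using (this.const_sub _).const_mul (√(2 * π))⁻¹

lemma continuous_plasmaF : Continuous plasmaF :=
  continuous_iff_continuousAt.2 fun t => (hasDerivAt_plasmaF t).continuousAt

@[fun_prop]
lemma measurable_plasmaF : Measurable plasmaF := continuous_plasmaF.measurable

/-- Substituting p = r - 2u produces exactly the Gaussian tail defining F. This is the source of the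
cancellation of 1/F in `integral_density_two_mul`. -/
lemma integral_gaussian_two_mul_Iio (r : ℝ) :
    ∫ u in Iio (0 : ℝ), exp (-(2 * u - r) ^ 2 / 2) = √(2 * π) / 2 * plasmaF r := by
  rw [plasmaF_eq, ← integral_Iic_eq_integral_Iio]
  have h := integral_comp_neg_Ioi (0 : ℝ) (fun u : ℝ => exp (-(2 * u - r) ^ 2 / 2))
  rw [neg_zero] at h
  rw [← h]
  have h1 := integral_comp_mul_left_Ioi (fun p : ℝ => exp (-(p + r) ^ 2 / 2)) 0 (b := 2)
    (by norm_num)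
  have h2 := (measurePreserving_add_right volume r).setIntegral_preimage_emb
    (measurableEmbedding_addRight r) (fun p : ℝ => exp (-p ^ 2 / 2)) (Ioi r)
  rw [preimage_add_const_Ioi, sub_self] at h2
  rw [mul_zero, h2] at h1
  have e : ∀ p : ℝ, -(2 * -p - r) ^ 2 / 2 = -(2 * p + r) ^ 2 / 2 := fun p => by ring
  simp only [e, h1, smul_eq_mul]
  have : √(2 * π) ≠ 0 := by positivity
  field_simp

lemma integrable_gaussian_two_mul (r : ℝ) :
    Integrable fun u : ℝ => exp (-(2 * u - r) ^ 2 / 2) := by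
  simpa using (integrable_exp_neg_sq_div_two.comp_sub_right r).comp_mul_left' (R := 2) (by norm_num)

/-! ### The Gaussian weighted by 1/F -/

/-- The Gaussian `exp (-(s-t)²/2)` weighted by `1 / F(t)`. -/
def density (s t : ℝ) : ℝ := exp (-(s - t) ^ 2 / 2) * (plasmaF t)⁻¹

/-- The total mass of the weighted Gaussian on the negative half-line. -/
def mass (s : ℝ) : ℝ := ∫ t in Iio (0 : ℝ), density s t

/-- The cumulative mass of the weighted Gaussian. -/
def cumul (s r : ℝ) : ℝ := ∫ t in Iio r, density s t

lemma density_pos (s : ℝ) {t : ℝ} (ht : t ≤ 0) : 0 < density s t :=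
  mul_pos (exp_pos _) (inv_pos.2 (plasmaF_pos ht))

lemma density_le (s : ℝ) {t : ℝ} (ht : t ≤ 0) : density s t ≤ 2 * exp (-(s - t) ^ 2 / 2) := by
  rw [density, mul_comm]
  gcongr
  exact inv_plasmaF_le ht

@[fun_prop]
lemma measurable_density : Measurable fun p : ℝ × ℝ => density p.1 p.2 := by
  unfold density; fun_prop

@[fun_prop]
lemma measurable_density_right (s : ℝ) : Measurable (density s) := by
  unfold density; fun_prop

lemma integrable_gaussian_sub (s : ℝ) : Integrable fun t : ℝ => exp (-(s - t) ^ 2 / 2) :=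
  integrable_exp_neg_sq_div_two.comp_sub_left s

lemma integrableOn_density (s : ℝ) : IntegrableOn (density s) (Iic 0) := by
  refine ((integrable_gaussian_sub s).const_mul 2).integrableOn.mono'
    (by fun_prop) ?_
  filter_upwards [ae_restrict_mem measurableSet_Iic] with t ht
  rw [Real.norm_of_nonneg (density_pos s ht).le]
  exact density_le s ht

lemma integrableOn_density_Iio (s : ℝ) {r : ℝ} (hr : r ≤ 0) :
    IntegrableOn (density s) (Iio r) :=
  (integrableOn_density s).mono_set fun _ ht => (mem_Iio.1 ht).le.trans hr

lemma mass_pos (s : ℝ) : 0 < mass s := by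
  rw [mass, setIntegral_pos_iff_support_of_nonneg_ae]
  · have : Function.support (density s) ∩ Iio 0 = Iio 0 := by
      ext t
      simp only [mem_inter_iff, Function.mem_support, mem_Iio, and_iff_right_iff_imp]
      exact fun ht => (density_pos s ht.le).ne'
    rw [this]; simp
  · filter_upwards [ae_restrict_mem measurableSet_Iio] with t ht
    exact (density_pos s (mem_Iio.1 ht).le).le
  · exact integrableOn_density_Iio s le_rfl

lemma hasDerivAt_density (s : ℝ) {t : ℝ} (ht : t ≤ 0) :
    HasDerivAt (density s)
      ((s - t) * density s t + density s t * ((√(2 * π))⁻¹ * exp (-t ^ 2 / 2) * (plasmaF t)⁻¹)) t := by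
  have h1 : HasDerivAt (fun t : ℝ => exp (-(s - t) ^ 2 / 2)) (exp (-(s - t) ^ 2 / 2) * (s - t)) t := by
    have := ((((hasDerivAt_id t).const_sub s).pow 2).neg.div_const 2).exp
    convert! this using 1
    simp
  have h2 := (hasDerivAt_plasmaF t).inv (plasmaF_pos ht).ne'
  refine (h1.mul h2).congr_deriv ?_
  have := (plasmaF_pos ht).ne'
  simp only [density, Pi.inv_apply]
  field_simp

/-! ### Parseval's identity and the one-sided exponential -/

lemma conj_fourier_mul_fourier (f : ℝ → ℂ) (ξ : ℝ) :
    conj (𝓕 f ξ) * 𝓕 f ξ = ((‖𝓕 f ξ‖ ^ 2 : ℝ) : ℂ) := by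
  rw [mul_comm, Complex.mul_conj, Complex.normSq_eq_norm_sq]

/-- The left integrand is conj(ĝ) times the transform of g * e, so Parseval applies. Continuity of g
* e and integrability of its transform give Fourier inversion at every point; reality of g removes
the remaining conjugate. -/
lemma integral_normSq_fourier_mul_fourier {g e : ℝ → ℂ} (hg : Integrable g) (he : Integrable e)
    (hcont : ∀ r, ContinuousAt (fun r => ∫ t, g t * e (r - t)) r)
    (hreal : ∀ t, conj (g t) = g t) (hint : Integrable fun ξ => 𝓕 g ξ * 𝓕 e ξ) :
    ∫ ξ, ((‖𝓕 g ξ‖ ^ 2 : ℝ) : ℂ) * 𝓕 e ξ = ∫ r, g r * ∫ t, g t * e (r - t) := by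
  have hk : convolution g e (ContinuousLinearMap.mul ℂ ℂ) volume
      = fun r => ∫ t, g t * e (r - t) := by
    ext r; rw [convolution_mul]
  have hF : ∀ ξ, 𝓕 (fun r => ∫ t, g t * e (r - t)) ξ = 𝓕 g ξ * 𝓕 e ξ := fun ξ => by
    rw [← hk, Real.fourier_mul_convolution_eq hg he]
  have hkint : Integrable fun r => ∫ t, g t * e (r - t) := by
    rw [← hk]; exact hg.integrable_convolution _ he
  have hFint : Integrable (𝓕 (fun r => ∫ t, g t * e (r - t))) := by
    simpa only [funext hF] using hint
  have hflip := VectorFourier.integral_sesq_fourierIntegral_eq_neg_flip (innerSL ℂ (E := ℂ))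
    (L := innerₗ ℝ) Real.continuous_fourierChar continuous_inner hg hFint
  rw [flip_innerₗ] at hflip
  calc ∫ ξ, ((‖𝓕 g ξ‖ ^ 2 : ℝ) : ℂ) * 𝓕 e ξ
      = ∫ ξ, inner ℂ (𝓕 g ξ) (𝓕 (fun r => ∫ t, g t * e (r - t)) ξ) := by
        refine integral_congr_ae (ae_of_all _ fun ξ => ?_)
        simp only [hF, RCLike.inner_apply']
        rw [← mul_assoc, conj_fourier_mul_fourier]
    _ = ∫ r, inner ℂ (g r) (𝓕⁻ (𝓕 (fun r => ∫ t, g t * e (r - t))) r) := hflip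
    _ = ∫ r, g r * ∫ t, g t * e (r - t) := by
        refine integral_congr_ae (ae_of_all _ fun r => ?_)
        simp only [RCLike.inner_apply', hreal, hkint.fourierInv_fourier_eq hFint (hcont r)]

/-- A jump of e at 0 affects the integrand only at t = r, a null set, so dominated convergence still
applies. -/
lemma continuousAt_convolution_of_bounded {g e : ℝ → ℂ} (hg : Integrable g)
    (hem : AEStronglyMeasurable e) (hb : ∀ t, ‖e t‖ ≤ 1) (hc : ∀ t ≠ 0, ContinuousAt e t) (r : ℝ) :
    ContinuousAt (fun r => ∫ t, g t * e (r - t)) r := by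
  refine continuousAt_of_dominated (bound := fun t => ‖g t‖) ?_ ?_ hg.norm ?_
  · refine Eventually.of_forall fun x => hg.aestronglyMeasurable.mul ?_
    exact hem.comp_quasiMeasurePreserving (volume.measurePreserving_sub_left x).quasiMeasurePreserving
  · refine Eventually.of_forall fun x => ae_of_all _ fun t => ?_
    rw [norm_mul]
    exact mul_le_of_le_one_right (norm_nonneg _) (hb _)
  · have : ∀ᵐ t : ℝ, t ≠ r := by
      simp [ae_iff]
    filter_upwards [this] with t ht
    refine continuousAt_const.mul (ContinuousAt.comp (f := fun r => r - t) ?_ (by fun_prop))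
    exact hc _ (sub_ne_zero.2 ht.symm)

/-- The integrable fundamental solution of `f' + a f = δ`, for `a ≠ 0`. -/
def expKernel (a : ℝ) : ℝ → ℂ :=
  if 0 < a then (Ioi 0).indicator fun t => Complex.exp (-a * t)
  else fun t => -(Iic 0).indicator (fun t : ℝ => Complex.exp (-a * t)) t

lemma integrable_expKernel {a : ℝ} (ha : a ≠ 0) : Integrable (expKernel a) := by
  unfold expKernel
  split_ifs with h
  · exact (integrableOn_exp_mul_complex_Ioi (by simpa using h) 0).integrable_indicator
      measurableSet_Ioi
  · have h' : a < 0 := lt_of_le_of_ne (not_lt.1 h) ha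
    exact ((integrableOn_exp_mul_complex_Iic (by simpa using h') 0).integrable_indicator
      measurableSet_Iic).neg

lemma norm_expKernel_le (a t : ℝ) : ‖expKernel a t‖ ≤ 1 := by
  unfold expKernel
  split_ifs with h
  · by_cases ht : t ∈ Ioi (0 : ℝ)
    · rw [indicator_of_mem ht, Complex.norm_exp]
      have : 0 < t := ht
      simp; positivity
    · simp [indicator_of_notMem ht]
  · rw [norm_neg]
    by_cases ht : t ∈ Iic (0 : ℝ)
    · rw [indicator_of_mem ht, Complex.norm_exp]
      have : t ≤ 0 := ht
      simp; nlinarith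
    · simp [indicator_of_notMem ht]

lemma continuousAt_expKernel (a : ℝ) {t : ℝ} (ht : t ≠ 0) : ContinuousAt (expKernel a) t := by
  unfold expKernel
  have hc : Continuous fun t : ℝ => Complex.exp (-a * t) := by fun_prop
  have h0 : t ∉ frontier (Ioi (0 : ℝ)) := by simpa [frontier_Ioi] using ht
  have h1 : t ∉ frontier (Iic (0 : ℝ)) := by simpa [frontier_Iic] using ht
  split_ifs with h
  · exact hc.continuousOn.continuousAt_indicator h0
  · exact (hc.continuousOn.continuousAt_indicator h1).neg

/-- With a = x - u this is the Cauchy kernel along a vertical line. The sign of a decides which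
half-line carries the integrable exponential. -/
lemma fourier_expKernel {a : ℝ} (ha : a ≠ 0) (ξ : ℝ) :
    𝓕 (expKernel a) ξ = 1 / (a + 2 * π * ξ * Complex.I) := by
  rw [Real.fourier_real_eq_integral_exp_smul]
  have e : ∀ t : ℝ, Complex.exp (↑(-2 * π * t * ξ) * Complex.I) * Complex.exp (-a * t)
      = Complex.exp (-(a + 2 * π * ξ * Complex.I) * t) := fun t => by
    rw [← Complex.exp_add]; congr 1; push_cast; ring
  unfold expKernel
  split_ifs with h
  · have : (fun t : ℝ => Complex.exp (↑(-2 * π * t * ξ) * Complex.I) •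
        (Ioi 0).indicator (fun t : ℝ => Complex.exp (-a * t)) t)
        = (Ioi 0).indicator fun t : ℝ => Complex.exp (-(a + 2 * π * ξ * Complex.I) * t) := by
      ext t
      by_cases ht : t ∈ Ioi (0 : ℝ)
      · rw [indicator_of_mem ht, indicator_of_mem ht, smul_eq_mul, e]
      · rw [indicator_of_notMem ht, indicator_of_notMem ht, smul_zero]
    rw [this, integral_indicator measurableSet_Ioi,
      integral_exp_mul_complex_Ioi (by simpa using h)]
    rw [Complex.ofReal_zero, mul_zero, Complex.exp_zero, neg_div_neg_eq]
  · have h' : a < 0 := lt_of_le_of_ne (not_lt.1 h) ha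
    have : (fun t : ℝ => Complex.exp (↑(-2 * π * t * ξ) * Complex.I) •
        (-(Iic 0).indicator (fun t : ℝ => Complex.exp (-a * t)) t))
        = fun t => -(Iic 0).indicator
          (fun t : ℝ => Complex.exp (-(a + 2 * π * ξ * Complex.I) * t)) t := by
      ext t
      by_cases ht : t ∈ Iic (0 : ℝ)
      · rw [indicator_of_mem ht, indicator_of_mem ht, smul_eq_mul, mul_neg, e]
      · rw [indicator_of_notMem ht, indicator_of_notMem ht]; simp
    rw [this, integral_neg, integral_indicator measurableSet_Iic,
      integral_exp_mul_complex_Iic (by simpa using h')]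
    rw [Complex.ofReal_zero, mul_zero, Complex.exp_zero, div_neg, neg_neg]

/-! ### Fourier decay of the truncated density, uniformly in the parameter -/

/-- The weighted Gaussian restricted to the negative half-line, as a complex function. -/
def cutDensity (s : ℝ) : ℝ → ℂ := (Iio 0).indicator fun t => (density s t : ℂ)

lemma integrable_cutDensity (s : ℝ) : Integrable (cutDensity s) := by
  have h : IntegrableOn (fun t => (density s t : ℂ)) (Iio 0) :=
    (integrableOn_density_Iio s le_rfl).ofReal
  exact h.integrable_indicator measurableSet_Iio

lemma conj_cutDensity (s t : ℝ) : conj (cutDensity s t) = cutDensity s t := by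
  by_cases ht : t ∈ Iio (0 : ℝ)
  · simp [cutDensity, indicator_of_mem ht]
  · simp [cutDensity, indicator_of_notMem ht]

lemma fourier_cutDensity (s ξ : ℝ) :
    𝓕 (cutDensity s) ξ
      = ∫ t in Iio (0 : ℝ), Complex.exp (-(2 * π * ξ * Complex.I) * t) * density s t := by
  rw [Real.fourier_real_eq_integral_exp_smul, ← integral_indicator measurableSet_Iio]
  congr 1
  ext t
  by_cases ht : t ∈ Iio (0 : ℝ)
  · rw [cutDensity, indicator_of_mem ht, indicator_of_mem ht, smul_eq_mul]
    congr 2; push_cast; ring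
  · rw [cutDensity, indicator_of_notMem ht, indicator_of_notMem ht, smul_zero]

lemma norm_exp_phase (ξ t : ℝ) : ‖Complex.exp (-(2 * π * ξ * Complex.I) * t)‖ = 1 := by
  rw [Complex.norm_exp]; simp

lemma mass_le (s : ℝ) : mass s ≤ 2 * √(2 * π) := by
  calc mass s ≤ ∫ t in Iio (0 : ℝ), 2 * exp (-(s - t) ^ 2 / 2) := by
        refine setIntegral_mono_on (integrableOn_density_Iio s le_rfl)
          ((integrable_gaussian_sub s).const_mul 2).integrableOn measurableSet_Iio ?_
        exact fun t ht => density_le s (mem_Iio.1 ht).le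
    _ ≤ ∫ t, 2 * exp (-(s - t) ^ 2 / 2) :=
        setIntegral_le_integral ((integrable_gaussian_sub s).const_mul 2)
          (ae_of_all _ fun t => by positivity)
    _ = 2 * √(2 * π) := by
        rw [integral_const_mul, integral_sub_left_eq_self (fun p => exp (-p ^ 2 / 2)) volume s,
          integral_exp_neg_sq_div_two]

lemma norm_fourier_cutDensity_le_mass (s ξ : ℝ) : ‖𝓕 (cutDensity s) ξ‖ ≤ mass s := by
  rw [fourier_cutDensity]
  refine (norm_integral_le_integral_norm _).trans_eq ?_
  refine setIntegral_congr_fun measurableSet_Iio fun t ht => ?_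
  simp only [norm_mul, norm_exp_phase, one_mul, Complex.norm_real]
  exact Real.norm_of_nonneg (density_pos s (mem_Iio.1 ht).le).le

/-- The derivative of the weighted Gaussian in its integration variable. -/
def densityDeriv (s t : ℝ) : ℝ :=
  (s - t) * density s t + density s t * ((√(2 * π))⁻¹ * exp (-t ^ 2 / 2) * (plasmaF t)⁻¹)

@[fun_prop]
lemma measurable_densityDeriv (s : ℝ) : Measurable (densityDeriv s) := by
  unfold densityDeriv; fun_prop

/-- A translation invariant majorant of the derivative of the weighted Gaussian. -/
def derivBound (p : ℝ) : ℝ := 2 * (|p| * exp (-p ^ 2 / 2)) + 4 * exp (-p ^ 2 / 2)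

lemma integrable_derivBound : Integrable derivBound := by
  have h : Integrable fun p : ℝ => |p| * exp (-p ^ 2 / 2) := by
    have := (integrable_mul_exp_neg_mul_sq (b := (1 / 2 : ℝ)) (by norm_num)).norm
    refine this.congr (ae_of_all _ fun p => ?_)
    simp only [norm_mul, Real.norm_eq_abs, abs_exp]
    congr 2; ring
  exact (h.const_mul 2).add (integrable_exp_neg_sq_div_two.const_mul 4)

lemma derivBound_nonneg (p : ℝ) : 0 ≤ derivBound p := by unfold derivBound; positivity

lemma abs_densityDeriv_le (s : ℝ) {t : ℝ} (ht : t ≤ 0) :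
    |densityDeriv s t| ≤ derivBound (s - t) := by
  have hd := density_le s ht
  have hp := density_pos s ht
  have hF := inv_plasmaF_le ht
  have hF0 : 0 < (plasmaF t)⁻¹ := inv_pos.2 (plasmaF_pos ht)
  have h1 : (√(2 * π))⁻¹ ≤ 1 := by
    refine inv_le_one_of_one_le₀ (Real.one_le_sqrt.2 ?_)
    nlinarith [pi_gt_three]
  have h2 : exp (-t ^ 2 / 2) ≤ 1 := exp_le_one_iff.2 (by nlinarith [sq_nonneg t])
  -- This factor comes from differentiating 1/F. Its bound 2, times the 2 in `density_le`, gives the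
  -- 4 in `derivBound`.
  have h3 : (√(2 * π))⁻¹ * exp (-t ^ 2 / 2) * (plasmaF t)⁻¹ ≤ 1 * 1 * 2 := by gcongr
  calc |densityDeriv s t|
      ≤ |(s - t) * density s t|
        + |density s t * ((√(2 * π))⁻¹ * exp (-t ^ 2 / 2) * (plasmaF t)⁻¹)| := abs_add_le _ _
    _ = |s - t| * density s t
        + density s t * ((√(2 * π))⁻¹ * exp (-t ^ 2 / 2) * (plasmaF t)⁻¹) := by
        rw [abs_mul, abs_of_pos hp, abs_of_nonneg (by positivity :
          0 ≤ density s t * ((√(2 * π))⁻¹ * exp (-t ^ 2 / 2) * (plasmaF t)⁻¹))]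
    _ ≤ |s - t| * (2 * exp (-(s - t) ^ 2 / 2)) + (2 * exp (-(s - t) ^ 2 / 2)) * (1 * 1 * 2) := by
        gcongr
    _ = derivBound (s - t) := by unfold derivBound; ring

lemma integrableOn_densityDeriv (s : ℝ) : IntegrableOn (densityDeriv s) (Iic 0) := by
  refine (integrable_derivBound.comp_sub_left s).integrableOn.mono' (by fun_prop) ?_
  filter_upwards [ae_restrict_mem measurableSet_Iic] with t ht
  exact abs_densityDeriv_le s ht

lemma integral_abs_densityDeriv_le (s : ℝ) :
    ∫ t in Iic (0 : ℝ), |densityDeriv s t| ≤ ∫ p, derivBound p := by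
  calc ∫ t in Iic (0 : ℝ), |densityDeriv s t| ≤ ∫ t in Iic (0 : ℝ), derivBound (s - t) :=
        setIntegral_mono_on (integrableOn_densityDeriv s).abs
          (integrable_derivBound.comp_sub_left s).integrableOn measurableSet_Iic
          fun t ht => abs_densityDeriv_le s ht
    _ ≤ ∫ t, derivBound (s - t) :=
        setIntegral_le_integral (integrable_derivBound.comp_sub_left s)
          (ae_of_all _ fun t => derivBound_nonneg _)
    _ = ∫ p, derivBound p := integral_sub_left_eq_self _ volume s

lemma integrableOn_phase_mul (ξ : ℝ) {f : ℝ → ℝ} (hf : IntegrableOn f (Iic 0)) :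
    IntegrableOn (fun t : ℝ => Complex.exp (-(2 * π * ξ * Complex.I) * t) * f t) (Iic 0) := by
  refine (hf.ofReal (𝕜 := ℂ)).bdd_mul (c := 1) ?_ (ae_of_all _ fun t => (norm_exp_phase ξ t).le)
  exact Continuous.aestronglyMeasurable (by fun_prop)

/-- Integration by parts on the half-line. The jump at 0 leaves the boundary term `density s 0`, at
most 2, so the decay is only of order 1/|ξ|; the constant does not depend on s because the majorant
is a translate of a fixed function. -/
lemma mul_norm_fourier_cutDensity_le (s ξ : ℝ) :
    2 * π * |ξ| * ‖𝓕 (cutDensity s) ξ‖ ≤ 2 + ∫ p, derivBound p := by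
  set c : ℂ := 2 * π * ξ * Complex.I with hc
  have hd : ∀ t ∈ Iic (0 : ℝ), HasDerivAt
      (fun t : ℝ => Complex.exp (-c * t) * density s t)
      (-c * (Complex.exp (-c * t) * density s t) + Complex.exp (-c * t) * densityDeriv s t) t := by
    intro t ht
    have h1 : HasDerivAt (fun t : ℝ => Complex.exp (-c * t)) (Complex.exp (-c * t) * (-c)) t := by
      simpa using ((hasDerivAt_id t).ofReal_comp.const_mul (-c)).cexp
    exact (h1.mul (hasDerivAt_density s ht).ofReal_comp).congr_deriv (by
      rw [densityDeriv]; ring)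
  have i1 := integrableOn_phase_mul ξ (integrableOn_density s)
  have i2 := integrableOn_phase_mul ξ (integrableOn_densityDeriv s)
  rw [← hc] at i1 i2
  have i3 := (i1.const_mul (-c)).add i2
  -- A function integrable together with its derivative vanishes at -∞, so only the endpoint 0
  -- contributes.
  have hlim := tendsto_zero_of_hasDerivAt_of_integrableOn_Iic hd i3 i1
  have hI := integral_Iic_of_hasDerivAt_of_tendsto' hd i3 hlim
  rw [integral_add (i1.const_mul (-c)) i2, integral_const_mul, integral_Iic_eq_integral_Iio,
    hc, ← fourier_cutDensity, ← hc] at hI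
  have hc' : ‖c‖ = 2 * π * |ξ| := by
    simp [hc, abs_of_pos pi_pos]
  have e : c * 𝓕 (cutDensity s) ξ
      = (∫ t in Iic (0 : ℝ), Complex.exp (-c * t) * densityDeriv s t) - density s 0 := by
    simp only [Complex.ofReal_zero, mul_zero, Complex.exp_zero, one_mul, sub_zero] at hI
    linear_combination -hI
  rw [← hc', ← norm_mul, e, add_comm]
  refine (norm_sub_le _ _).trans (add_le_add ?_ ?_)
  · refine (norm_integral_le_integral_norm _).trans (le_of_eq_of_le ?_ (integral_abs_densityDeriv_le s))
    refine integral_congr_ae (ae_of_all _ fun t => ?_)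
    simp only [norm_mul, hc, norm_exp_phase, one_mul, Complex.norm_real, Real.norm_eq_abs]
  · rw [Complex.norm_real, Real.norm_of_nonneg (density_pos s le_rfl).le]
    refine (density_le s le_rfl).trans ?_
    have : exp (-(s - 0) ^ 2 / 2) ≤ 1 := exp_le_one_iff.2 (by nlinarith [sq_nonneg (s - 0)])
    linarith

lemma exists_normSq_fourier_cutDensity_le :
    ∃ C : ℝ, ∀ s ξ, ‖𝓕 (cutDensity s) ξ‖ ^ 2 ≤ C * (1 + ξ ^ 2)⁻¹ := by
  refine ⟨(2 * √(2 * π)) ^ 2 + (2 + ∫ p, derivBound p) ^ 2, fun s ξ => ?_⟩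
  rw [← div_eq_mul_inv, le_div_iff₀ (by positivity)]
  have h1 := (norm_fourier_cutDensity_le_mass s ξ).trans (mass_le s)
  have h2 := mul_norm_fourier_cutDensity_le s ξ
  have h3 : |ξ| * ‖𝓕 (cutDensity s) ξ‖ ≤ 2 + ∫ p, derivBound p := by
    refine le_trans ?_ h2
    rw [mul_assoc]
    refine le_mul_of_one_le_left (by positivity) ?_
    nlinarith [pi_gt_three]
  have h4 := pow_le_pow_left₀ (norm_nonneg _) h1 2
  have h5 := pow_le_pow_left₀ (by positivity) h3 2
  rw [mul_pow, sq_abs] at h5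
  linarith

lemma continuous_fourier_of_integrable {f : ℝ → ℂ} (hf : Integrable f) : Continuous (𝓕 f) :=
  VectorFourier.fourierIntegral_continuous Real.continuous_fourierChar
    (by exact continuous_inner) hf

lemma norm_add_two_pi_mul_I (a ξ : ℝ) :
    ‖(a + 2 * π * ξ * Complex.I : ℂ)‖ ^ 2 = a ^ 2 + 4 * π ^ 2 * ξ ^ 2 := by
  rw [← Complex.normSq_eq_norm_sq, Complex.normSq_apply]
  simp; ring

lemma integrable_fourier_cutDensity_mul (s : ℝ) {a : ℝ} (ha : a ≠ 0) :
    Integrable fun ξ => 𝓕 (cutDensity s) ξ * 𝓕 (expKernel a) ξ := by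
  obtain ⟨C, hC⟩ := exists_normSq_fourier_cutDensity_le
  refine (integrable_inv_one_add_sq.const_mul (C + ((a ^ 2)⁻¹ + 1))).mono'
    ((continuous_fourier_of_integrable (integrable_cutDensity s)).mul
      (continuous_fourier_of_integrable (integrable_expKernel ha))).aestronglyMeasurable
    (ae_of_all _ fun ξ => ?_)
  have ha2 : 0 < a ^ 2 := by positivity
  have h1 := hC s ξ
  have h2 : ‖𝓕 (expKernel a) ξ‖ ^ 2 ≤ ((a ^ 2)⁻¹ + 1) * (1 + ξ ^ 2)⁻¹ := by
    rw [fourier_expKernel ha, norm_div, norm_one, div_pow, one_pow, norm_add_two_pi_mul_I,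
      ← div_eq_mul_inv, div_le_div_iff₀ (by positivity) (by positivity)]
    have : (a ^ 2)⁻¹ * a ^ 2 = 1 := inv_mul_cancel₀ ha2.ne'
    have h3 : 0 ≤ (a ^ 2)⁻¹ * (4 * π ^ 2 * ξ ^ 2) := by positivity
    have h4 : 0 ≤ (π ^ 2 - 1) * ξ ^ 2 :=
      mul_nonneg (by nlinarith [pi_gt_three]) (sq_nonneg _)
    nlinarith [sq_nonneg (π * ξ)]
  rw [norm_mul]
  -- Neither transform need be integrable alone, but both squares are O((1 + ξ²)⁻¹), and 2ab ≤ a² +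
  -- b² handles the product.
  nlinarith [sq_nonneg (‖𝓕 (cutDensity s) ξ‖ - ‖𝓕 (expKernel a) ξ‖),
    sq_nonneg (‖𝓕 (cutDensity s) ξ‖), sq_nonneg ‖𝓕 (expKernel a) ξ‖]

lemma integral_normSq_fourier_cutDensity_div (s : ℝ) {a : ℝ} (ha : a ≠ 0) :
    ∫ ξ, ((‖𝓕 (cutDensity s) ξ‖ ^ 2 : ℝ) : ℂ) / (a + 2 * π * ξ * Complex.I)
      = ∫ r in Iio (0 : ℝ), density s r * ∫ t, cutDensity s t * expKernel a (r - t) := by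
  have h := integral_normSq_fourier_mul_fourier (integrable_cutDensity s) (integrable_expKernel ha)
    (continuousAt_convolution_of_bounded (integrable_cutDensity s)
      (integrable_expKernel ha).aestronglyMeasurable (norm_expKernel_le a)
      fun t ht => continuousAt_expKernel a ht)
    (conj_cutDensity s) (integrable_fourier_cutDensity_mul s ha)
  simp only [fourier_expKernel ha, mul_one_div] at h
  rw [h, ← integral_indicator measurableSet_Iio]
  refine integral_congr_ae (ae_of_all _ fun r => ?_)
  by_cases hr : r ∈ Iio (0 : ℝ)
  · simp only [cutDensity, indicator_of_mem hr]
  · simp only [cutDensity, indicator_of_notMem hr, zero_mul]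

/-! ### Separating the variables x and u -/

lemma exp_mul_density_mul_density (x u r t : ℝ) :
    exp (-(x - u) ^ 2) * density (x + u) r * (density (x + u) t * exp (-(x - u) * (r - t)))
      = density (2 * u) r * density (2 * x) t := by
  have e : exp (-(x - u) ^ 2) * exp (-(x + u - r) ^ 2 / 2) * exp (-(x + u - t) ^ 2 / 2)
      * exp (-(x - u) * (r - t)) = exp (-(2 * u - r) ^ 2 / 2) * exp (-(2 * x - t) ^ 2 / 2) := by
    simp only [← exp_add]
    congr 1; ring
  unfold density
  linear_combination (plasmaF r)⁻¹ * (plasmaF t)⁻¹ * e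

/-- For u < x the exponential selects t < r and yields the cumulative mass. For x < u it selects r ≤
t < 0 with a minus sign, and minus the upper mass is the cumulative mass minus the total. -/
lemma exp_mul_density_mul_convolution {x u r : ℝ} (hxu : x - u ≠ 0) (hr : r < 0) :
    (exp (-(x - u) ^ 2) : ℂ) * (density (x + u) r *
        ∫ t, cutDensity (x + u) t * expKernel (x - u) (r - t))
      = ((density (2 * u) r * (cumul (2 * x) r - if x < u then mass (2 * x) else 0) : ℝ) : ℂ) := by
  rw [← mul_assoc, ← integral_const_mul]
  have key : ∀ t : ℝ, (exp (-(x - u) ^ 2) : ℂ) * density (x + u) r *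
      (density (x + u) t * Complex.exp (-((x - u : ℝ) : ℂ) * ((r - t : ℝ) : ℂ)))
      = ((density (2 * u) r * density (2 * x) t : ℝ) : ℂ) := fun t => by
    rw [← exp_mul_density_mul_density]; push_cast; ring
  rcases lt_or_gt_of_ne hxu with h | h
  · have hlt : x < u := sub_neg.1 h
    have e : (fun t : ℝ => (exp (-(x - u) ^ 2) : ℂ) * density (x + u) r *
        (cutDensity (x + u) t * expKernel (x - u) (r - t)))
        = (Ico r 0).indicator fun t => -((density (2 * u) r * density (2 * x) t : ℝ) : ℂ) := by
      ext t
      simp only [expKernel, if_neg h.not_gt, cutDensity]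
      by_cases ht : t ∈ Ico r 0
      · have h1 : t ∈ Iio (0 : ℝ) := ht.2
        have h2 : r - t ∈ Iic (0 : ℝ) := sub_nonpos.2 ht.1
        rw [indicator_of_mem ht, indicator_of_mem h1, indicator_of_mem h2, ← key]
        ring
      · rw [indicator_of_notMem ht]
        by_cases h1 : t ∈ Iio (0 : ℝ)
        · have h2 : r - t ∉ Iic (0 : ℝ) := fun h2 => ht ⟨sub_nonpos.1 h2, h1⟩
          rw [indicator_of_notMem h2]; simp
        · rw [indicator_of_notMem h1]; simp
    have hsum : cumul (2 * x) r + ∫ t in Ico r 0, density (2 * x) t = mass (2 * x) := by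
      rw [cumul, mass, ← setIntegral_union _ measurableSet_Ico (integrableOn_density_Iio _ hr.le)
        ((integrableOn_density _).mono_set fun t ht => ht.2.le), Iio_union_Ico_eq_Iio hr.le]
      exact Set.disjoint_left.2 fun t ht h't => absurd h't.1 (not_le.2 ht)
    rw [e, integral_indicator measurableSet_Ico, integral_neg, integral_complex_ofReal, integral_const_mul,
      if_pos hlt, ← hsum]
    push_cast; ring
  · have hlt : ¬ x < u := not_lt.2 (sub_pos.1 h).le
    have e : (fun t : ℝ => (exp (-(x - u) ^ 2) : ℂ) * density (x + u) r *
        (cutDensity (x + u) t * expKernel (x - u) (r - t)))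
        = (Iio r).indicator fun t => ((density (2 * u) r * density (2 * x) t : ℝ) : ℂ) := by
      ext t
      simp only [expKernel, if_pos h, cutDensity]
      by_cases ht : t ∈ Iio r
      · have h1 : t ∈ Iio (0 : ℝ) := lt_trans ht hr
        have h2 : r - t ∈ Ioi (0 : ℝ) := mem_Ioi.2 (sub_pos.2 ht)
        rw [indicator_of_mem ht, indicator_of_mem h1, indicator_of_mem h2, ← key]
      · have h2 : r - t ∉ Ioi (0 : ℝ) := fun h2 => ht (mem_Iio.2 (sub_pos.1 (mem_Ioi.1 h2)))
        rw [indicator_of_notMem ht, indicator_of_notMem h2]; simp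
    rw [e, integral_indicator measurableSet_Iio, integral_complex_ofReal, integral_const_mul,
      if_neg hlt, cumul]
    push_cast; ring

lemma exp_mul_integral_normSq_fourier_div {x u : ℝ} (hxu : x - u ≠ 0) :
    (exp (-(x - u) ^ 2) : ℂ) *
        ∫ ξ, ((‖𝓕 (cutDensity (x + u)) ξ‖ ^ 2 : ℝ) : ℂ) / ((x - u : ℝ) + 2 * π * ξ * Complex.I)
      = ((∫ r in Iio (0 : ℝ),
          density (2 * u) r * (cumul (2 * x) r - if x < u then mass (2 * x) else 0) : ℝ) : ℂ) := by
  rw [integral_normSq_fourier_cutDensity_div _ hxu, ← integral_const_mul, ← integral_complex_ofReal]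
  exact setIntegral_congr_fun measurableSet_Iio fun r hr => exp_mul_density_mul_convolution hxu hr

/-! ### Integration over the real part u -/

/-- The first moment of the weighted Gaussian on the negative half-line. -/
def firstMoment (s : ℝ) : ℝ := ∫ t in Iio (0 : ℝ), t * density s t

lemma integrableOn_mul_density (s : ℝ) : IntegrableOn (fun t => t * density s t) (Iio 0) := by
  have h := ((integrable_derivBound.comp_sub_left s).add
    ((integrable_gaussian_sub s).const_mul (2 * |s|))).integrableOn (s := Iio (0 : ℝ))
  refine h.mono' (by fun_prop) ?_
  filter_upwards [ae_restrict_mem measurableSet_Iio] with t ht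
  have ht : t < 0 := ht
  have hd := density_le s ht.le
  have hp := density_pos s ht.le
  have h1 : |t| ≤ |s - t| + |s| := by
    have := abs_sub s (s - t)
    simpa [add_comm] using this
  rw [norm_mul, Real.norm_eq_abs, Real.norm_eq_abs, abs_of_pos hp]
  calc |t| * density s t ≤ (|s - t| + |s|) * (2 * exp (-(s - t) ^ 2 / 2)) := by gcongr
    _ ≤ _ := by
        simp only [derivBound, Pi.add_apply]
        have := exp_pos (-(s - t) ^ 2 / 2)
        nlinarith

/-- The section t < r < 0 has length -t, so this reduces to the finite first moment. It justifies
the Fubini step in `integral_cumul`. -/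
lemma integrable_indicator_density_prod (s : ℝ) :
    Integrable (fun p : ℝ × ℝ => {p : ℝ × ℝ | p.1 < p.2}.indicator (fun p => density s p.1) p)
      ((volume.restrict (Iio (0 : ℝ))).prod (volume.restrict (Iio (0 : ℝ)))) := by
  have hm : MeasurableSet {p : ℝ × ℝ | p.1 < p.2} := measurableSet_lt measurable_fst measurable_snd
  have hmeas : Measurable fun p : ℝ × ℝ =>
      {p : ℝ × ℝ | p.1 < p.2}.indicator (fun p => density s p.1) p :=
    Measurable.indicator (by fun_prop) hm
  have hsec : ∀ t : ℝ, (fun r : ℝ =>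
      {p : ℝ × ℝ | p.1 < p.2}.indicator (fun p => density s p.1) (t, r))
      = (Ioi t).indicator fun _ => density s t := by
    intro t; ext r
    simp [indicator]
  rw [integrable_prod_iff hmeas.aestronglyMeasurable]
  constructor
  · filter_upwards [ae_restrict_mem measurableSet_Iio] with t ht
    rw [hsec, integrable_indicator_iff measurableSet_Ioi, IntegrableOn,
      Measure.restrict_restrict measurableSet_Ioi, Ioi_inter_Iio]
    exact integrableOn_const (by simp)
  · refine (integrableOn_mul_density s).neg.congr ?_
    filter_upwards [ae_restrict_mem measurableSet_Iio] with t ht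
    have ht' : t < 0 := ht
    have hsec' : (fun r : ℝ =>
        ‖{p : ℝ × ℝ | p.1 < p.2}.indicator (fun p => density s p.1) (t, r)‖)
        = (Ioi t).indicator fun _ => density s t := by
      ext r
      rw [congrFun (hsec t) r, Real.norm_of_nonneg]
      exact indicator_nonneg (fun _ _ => (density_pos s ht'.le).le) _
    rw [hsec', integral_indicator measurableSet_Ioi,
      Measure.restrict_restrict measurableSet_Ioi, Ioi_inter_Iio, setIntegral_const]
    simp [Measure.real, ht'.le]

lemma integral_indicator_density_left (s : ℝ) {r : ℝ} (hr : r < 0) :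
    ∫ t in Iio (0 : ℝ), {p : ℝ × ℝ | p.1 < p.2}.indicator (fun p => density s p.1) (t, r)
      = cumul s r := by
  have : (fun t : ℝ => {p : ℝ × ℝ | p.1 < p.2}.indicator (fun p => density s p.1) (t, r))
      = (Iio r).indicator (density s) := by
    ext t; simp [indicator]
  rw [this, integral_indicator measurableSet_Iio, Measure.restrict_restrict measurableSet_Iio,
    Iio_inter_Iio, min_eq_left hr.le, cumul]

lemma integrableOn_cumul (s : ℝ) : IntegrableOn (cumul s) (Iio 0) := by
  refine (integrable_indicator_density_prod s).integral_prod_right.congr ?_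
  filter_upwards [ae_restrict_mem measurableSet_Iio] with r hr
  exact integral_indicator_density_left s hr

lemma integral_cumul (s : ℝ) : ∫ r in Iio (0 : ℝ), cumul s r = -firstMoment s := by
  have h := integral_integral_swap (f := fun t r =>
    {p : ℝ × ℝ | p.1 < p.2}.indicator (fun p => density s p.1) (t, r))
    (integrable_indicator_density_prod s)
  rw [setIntegral_congr_fun (s := Iio (0 : ℝ)) (g := cumul s) measurableSet_Iio
    (fun r hr => integral_indicator_density_left s hr)] at h
  rw [← h, firstMoment, ← integral_neg]
  refine setIntegral_congr_fun measurableSet_Iio fun t ht => ?_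
  have ht' : t < 0 := ht
  have hsec : (fun r : ℝ =>
      {p : ℝ × ℝ | p.1 < p.2}.indicator (fun p => density s p.1) (t, r))
      = (Ioi t).indicator fun _ => density s t := by
    ext r; simp [indicator]
  simp only [hsec]
  rw [integral_indicator measurableSet_Ioi,
      Measure.restrict_restrict measurableSet_Ioi, Ioi_inter_Iio, setIntegral_const]
  simp [Measure.real, ht'.le]

lemma cumul_nonneg (s : ℝ) {r : ℝ} (hr : r ≤ 0) : 0 ≤ cumul s r :=
  setIntegral_nonneg measurableSet_Iio fun _ ht => (density_pos s ((mem_Iio.1 ht).le.trans hr)).le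

/-- The u-integral produces F(r), which cancels the weight 1/F(r). -/
lemma integral_density_two_mul {r : ℝ} (hr : r ≤ 0) :
    ∫ u in Iio (0 : ℝ), density (2 * u) r = √(2 * π) / 2 := by
  unfold density
  rw [integral_mul_const, integral_gaussian_two_mul_Iio]
  have := (plasmaF_pos hr).ne'
  field_simp

lemma integrable_density_two_mul (r : ℝ) : Integrable fun u => density (2 * u) r :=
  (integrable_gaussian_two_mul r).mul_const _

lemma integrable_density_mul_cumul_prod (s : ℝ) :
    Integrable (fun p : ℝ × ℝ => density (2 * p.1) p.2 * cumul s p.2)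
      ((volume.restrict (Iio (0 : ℝ))).prod (volume.restrict (Iio (0 : ℝ)))) := by
  have hmeas : AEStronglyMeasurable (fun p : ℝ × ℝ => density (2 * p.1) p.2 * cumul s p.2)
      ((volume.restrict (Iio (0 : ℝ))).prod (volume.restrict (Iio (0 : ℝ)))) := by
    have h : Measurable fun p : ℝ × ℝ => density (2 * p.1) p.2 := by fun_prop
    exact h.aestronglyMeasurable.mul (integrableOn_cumul s).aestronglyMeasurable.comp_snd
  rw [integrable_prod_iff' hmeas]
  constructor
  · exact ae_of_all _ fun r => ((integrable_density_two_mul r).mul_const (cumul s r)).restrict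
  · refine ((integrableOn_cumul s).const_mul (√(2 * π) / 2)).congr ?_
    filter_upwards [ae_restrict_mem measurableSet_Iio] with r hr
    have hr' : r ≤ 0 := (mem_Iio.1 hr).le
    have : ∀ u, ‖density (2 * u) r * cumul s r‖ = density (2 * u) r * cumul s r := fun u =>
      Real.norm_of_nonneg (mul_nonneg (density_pos _ hr').le (cumul_nonneg s hr'))
    simp only [this]
    rw [integral_mul_const, integral_density_two_mul hr']

lemma integral_integral_density_mul_cumul (s : ℝ) :
    ∫ u in Iio (0 : ℝ), ∫ r in Iio (0 : ℝ), density (2 * u) r * cumul s r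
      = -(√(2 * π) / 2 * firstMoment s) := by
  rw [integral_integral_swap (f := fun u r => density (2 * u) r * cumul s r)
    (integrable_density_mul_cumul_prod s), neg_mul_eq_mul_neg, ← integral_cumul,
    ← integral_const_mul]
  refine setIntegral_congr_fun measurableSet_Iio fun r hr => ?_
  rw [integral_mul_const, integral_density_two_mul (mem_Iio.1 hr).le]

/-! ### The mass as a moment generating function -/

/-- The measure on the negative half-line whose moment generating function is the mass of the
weighted Gaussian, up to a Gaussian factor. -/
def baseMeasure : Measure ℝ :=
  (volume.restrict (Iio (0 : ℝ))).withDensity fun t => ENNReal.ofReal (density 0 t)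

/-- The moment generating function of the base measure. -/
def baseMGF : ℝ → ℝ := mgf id baseMeasure

lemma density_eq (s t : ℝ) :
    density s t = exp (-s ^ 2 / 2) * (density 0 t * exp (s * t)) := by
  have e : exp (-(s - t) ^ 2 / 2) = exp (-s ^ 2 / 2) * (exp (-(0 - t) ^ 2 / 2) * exp (s * t)) := by
    simp only [← exp_add]; congr 1; ring
  unfold density
  rw [e]; ring

lemma density_zero_mul_exp (s t : ℝ) :
    density 0 t * exp (s * t) = exp (s ^ 2 / 2) * density s t := by
  rw [density_eq s t, ← mul_assoc, ← exp_add, neg_div, add_neg_cancel, exp_zero, one_mul]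

lemma integral_baseMeasure (f : ℝ → ℝ) :
    ∫ t, f t ∂baseMeasure = ∫ t in Iio (0 : ℝ), density 0 t * f t := by
  rw [baseMeasure, integral_withDensity_eq_integral_toReal_smul (by fun_prop)
    (ae_of_all _ fun _ => ENNReal.ofReal_lt_top)]
  refine setIntegral_congr_fun measurableSet_Iio fun t ht => ?_
  simp only [smul_eq_mul]
  rw [ENNReal.toReal_ofReal (density_pos 0 (mem_Iio.1 ht).le).le]

lemma integrable_exp_baseMeasure (s : ℝ) : Integrable (fun t => exp (s * id t)) baseMeasure := by
  rw [baseMeasure, integrable_withDensity_iff_integrable_smul' (by fun_prop)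
    (ae_of_all _ fun _ => ENNReal.ofReal_lt_top)]
  refine ((integrableOn_density_Iio s le_rfl).const_mul (exp (s ^ 2 / 2))).congr ?_
  filter_upwards [ae_restrict_mem measurableSet_Iio] with t ht
  rw [ENNReal.toReal_ofReal (density_pos 0 (mem_Iio.1 ht).le).le, smul_eq_mul, id,
    density_zero_mul_exp]

lemma mem_interior_integrableExpSet (s : ℝ) :
    s ∈ interior (integrableExpSet id baseMeasure) := by
  have : integrableExpSet id baseMeasure = univ :=
    eq_univ_of_forall fun s => integrable_exp_baseMeasure s
  rw [this, interior_univ]; trivial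

lemma mass_eq_baseMGF (s : ℝ) : mass s = exp (-s ^ 2 / 2) * baseMGF s := by
  rw [baseMGF, mgf, integral_baseMeasure, mass, ← integral_const_mul]
  exact integral_congr_ae (ae_of_all _ fun t => density_eq s t)

/-- Gaussian decay makes every exponential moment finite, so the generating function is analytic on
the whole line. -/
lemma contDiff_baseMGF : ContDiff ℝ ∞ baseMGF :=
  contDiff_iff_contDiffAt.2 fun s => (analyticAt_mgf (mem_interior_integrableExpSet s)).contDiffAt

lemma firstMoment_eq_deriv_baseMGF (s : ℝ) :
    firstMoment s = exp (-s ^ 2 / 2) * deriv baseMGF s := by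
  rw [baseMGF, deriv_mgf (mem_interior_integrableExpSet s), integral_baseMeasure, firstMoment,
    ← integral_const_mul]
  refine integral_congr_ae (ae_of_all _ fun t => ?_)
  simp only [id]
  rw [density_eq s t]; ring

lemma baseMGF_pos (s : ℝ) : 0 < baseMGF s :=
  pos_of_mul_pos_right (mass_eq_baseMGF s ▸ mass_pos s) (exp_pos _).le

lemma contDiff_mass : ContDiff ℝ ∞ mass := by
  rw [show mass = fun s => exp (-s ^ 2 / 2) * baseMGF s from funext mass_eq_baseMGF]
  exact ContDiff.mul (by fun_prop) contDiff_baseMGF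

/-- The cumulative part gives the first moment by Fubini. The correction is present only for x < u <
0, where the r-integral of `density (2 * u)` is `mass (2 * u)`. -/
lemma integral_density_mul_cumul_sub (x : ℝ) (hx : x < 0) :
    ∫ u in Iio (0 : ℝ), ∫ r in Iio (0 : ℝ),
        density (2 * u) r * (cumul (2 * x) r - if x < u then mass (2 * x) else 0)
      = -(√(2 * π) / 2 * firstMoment (2 * x)) - mass (2 * x) * ∫ u in x..0, mass (2 * u) := by
  have hprod := integrable_density_mul_cumul_prod (2 * x)
  have hcont : Continuous fun u => mass (2 * x) * mass (2 * u) :=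
    continuous_const.mul (contDiff_mass.continuous.comp (by fun_prop))
  have hI2 : IntegrableOn ((Ioo x 0).indicator fun u => mass (2 * x) * mass (2 * u))
      (Iio (0 : ℝ)) := by
    refine Integrable.integrableOn ?_
    rw [integrable_indicator_iff measurableSet_Ioo]
    exact (hcont.integrableOn_Icc).mono_set Ioo_subset_Icc_self
  have hsec := hprod.prod_right_ae
  calc _ = ∫ u in Iio (0 : ℝ), ((∫ r in Iio (0 : ℝ), density (2 * u) r * cumul (2 * x) r)
        - (Ioo x 0).indicator (fun u => mass (2 * x) * mass (2 * u)) u) := by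
        refine integral_congr_ae ?_
        filter_upwards [hsec, ae_restrict_mem measurableSet_Iio] with u hu hu0
        have hu0 : u < 0 := hu0
        simp only [mul_sub]
        rw [integral_sub hu ((integrableOn_density_Iio _ le_rfl).mul_const _), integral_mul_const]
        congr 1
        by_cases h : x < u
        · rw [indicator_of_mem (show u ∈ Ioo x 0 from ⟨h, hu0⟩), if_pos h, mass, mul_comm, mass]
        · rw [indicator_of_notMem (fun h' : u ∈ Ioo x 0 => h h'.1), if_neg h, mul_zero]
    _ = _ := by
        rw [integral_sub hprod.integral_prod_left hI2, integral_integral_density_mul_cumul,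
          integral_indicator measurableSet_Ioo, Measure.restrict_restrict measurableSet_Ioo,
          inter_eq_left.2 Ioo_subset_Iio_self, integral_const_mul,
          intervalIntegral.integral_of_le hx.le, integral_Ioc_eq_integral_Ioo]

/-! ### The kernel in Fourier terms -/

lemma norm_fourier_cutDensity_neg (s ξ : ℝ) :
    ‖𝓕 (cutDensity s) (-ξ)‖ = ‖𝓕 (cutDensity s) ξ‖ := by
  have : 𝓕 (cutDensity s) (-ξ) = conj (𝓕 (cutDensity s) ξ) := by
    rw [fourier_cutDensity, fourier_cutDensity, ← integral_conj]
    congr 1; ext t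
    rw [map_mul, ← Complex.exp_conj, Complex.conj_ofReal]
    congr 2; simp [map_ofNat]
  rw [this, RCLike.norm_conj]

/-- Expanding, -(s + iτ - t)²/2 = τ²/2 - isτ + iτt - (s-t)²/2: a real factor, a constant phase, and
a Fourier integral. -/
lemma norm_plasmaH (s τ : ℝ) :
    ‖plasmaH (s + τ * Complex.I)‖
      = (√(2 * π))⁻¹ * (exp (τ ^ 2 / 2) * ‖𝓕 (cutDensity s) (τ / (2 * π))‖) := by
  -- The phase exp(iτt) corresponds to frequency -τ/(2π), so the sign is flipped first.
  rw [← norm_fourier_cutDensity_neg, fourier_cutDensity, plasmaH, norm_mul, norm_div, norm_one,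
    Complex.norm_real, Real.norm_of_nonneg (sqrt_nonneg _), one_div]
  congr 1
  have e : ∀ t : ℝ, Complex.exp (-(s + τ * Complex.I - t) ^ 2 / 2) / (plasmaF t : ℂ)
      = ((exp (τ ^ 2 / 2) : ℝ) : ℂ) * Complex.exp (((-(s * τ) : ℝ) : ℂ) * Complex.I) *
        (Complex.exp (-(2 * π * ((-(τ / (2 * π)) : ℝ) : ℂ) * Complex.I) * t) * density s t) := by
    intro t
    have hpi : (π : ℂ) ≠ 0 := by exact_mod_cast pi_ne_zero
    have e1 : Complex.exp (-(s + τ * Complex.I - t) ^ 2 / 2)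
        = Complex.exp ((τ ^ 2 / 2 : ℝ)) * Complex.exp (((-(s * τ) : ℝ) : ℂ) * Complex.I) *
        Complex.exp (-(2 * π * ((-(τ / (2 * π)) : ℝ) : ℂ) * Complex.I) * t)
          * Complex.exp ((-(s - t) ^ 2 / 2 : ℝ)) := by
      simp only [← Complex.exp_add]
      congr 1
      push_cast
      field_simp
      linear_combination (-(τ : ℂ) ^ 2) * Complex.I_sq
    rw [e1, density]
    push_cast
    rw [div_eq_mul_inv]
    ring
  simp only [e]
  rw [integral_const_mul, norm_mul, norm_mul, Complex.norm_exp_ofReal_mul_I, mul_one,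
    Complex.norm_real, Real.norm_of_nonneg (exp_pos _).le]

lemma plasmaH_ofReal (s : ℝ) : plasmaH s = (((√(2 * π))⁻¹ * mass s : ℝ) : ℂ) := by
  have e : ∀ t : ℝ, Complex.exp (-((s : ℂ) - t) ^ 2 / 2) / (plasmaF t : ℂ) = (density s t : ℂ) := by
    intro t
    rw [density]; push_cast; rw [div_eq_mul_inv]
  rw [plasmaH]
  simp only [e]
  rw [integral_complex_ofReal, mass]
  push_cast
  rw [one_div]

lemma norm_ginibreKernel (z w : ℂ) :
    ‖ginibreKernel z w‖ = exp (-((z.re - w.re) ^ 2 + (z.im - w.im) ^ 2) / 2) := by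
  rw [ginibreKernel, Complex.norm_exp]
  congr 1
  simp only [Complex.sub_re, Complex.mul_re, Complex.conj_re, Complex.conj_im, Complex.ofReal_re,
    ← Complex.normSq_eq_norm_sq, Complex.normSq_apply]
  ring

lemma kernel_of_mem {z w : ℂ} (hz : z ∈ leftHalfPlane) (hw : w ∈ leftHalfPlane) :
    kernel z w = ginibreKernel z w * plasmaH (z + conj w) := by
  simp [kernel, indicator_of_mem hz, indicator_of_mem hw]

/-- The growth exp(τ²/2) of H exactly cancels the decay of the Ginibre factor in the imaginary
direction, leaving the Fourier transform as the only dependence on y - v. -/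
lemma norm_kernel_sq {z w : ℂ} (hz : z ∈ leftHalfPlane) (hw : w ∈ leftHalfPlane) :
    ‖kernel z w‖ ^ 2 = (2 * π)⁻¹ * (exp (-(z.re - w.re) ^ 2) *
      ‖𝓕 (cutDensity (z.re + w.re)) ((z.im - w.im) / (2 * π))‖ ^ 2) := by
  have e : z + conj w = ((z.re + w.re : ℝ) : ℂ) + ((z.im - w.im : ℝ) : ℂ) * Complex.I := by
    apply Complex.ext <;> simp [sub_eq_add_neg]
  have e1 : exp (-((z.re - w.re) ^ 2 + (z.im - w.im) ^ 2) / 2) ^ 2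
      * exp ((z.im - w.im) ^ 2 / 2) ^ 2 = exp (-(z.re - w.re) ^ 2) := by
    rw [← exp_nat_mul, ← exp_nat_mul, ← exp_add]; congr 1; push_cast; ring
  rw [kernel_of_mem hz hw, norm_mul, e, norm_plasmaH, norm_ginibreKernel, ← e1, mul_pow, mul_pow,
    mul_pow, inv_pow, sq_sqrt (by positivity)]
  ring

lemma kernel_self {z : ℂ} (hz : z ∈ leftHalfPlane) :
    kernel z z = (((√(2 * π))⁻¹ * mass (2 * z.re) : ℝ) : ℂ) := by
  have e : z + conj z = ((2 * z.re : ℝ) : ℂ) := by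
    rw [Complex.add_conj]
  have h1 : ginibreKernel z z = 1 := by
    rw [ginibreKernel, Complex.mul_conj, Complex.normSq_eq_norm_sq]
    rw [← Complex.exp_zero]; congr 1; push_cast; ring
  rw [kernel_of_mem hz hz, h1, one_mul, e, plasmaH_ofReal]

lemma onePoint_eq {z : ℂ} (hz : z ∈ leftHalfPlane) :
    onePoint z = (√(2 * π))⁻¹ * mass (2 * z.re) := by
  rw [onePoint, kernel_self hz, Complex.ofReal_re]

lemma onePoint_pos {z : ℂ} (hz : z ∈ leftHalfPlane) : 0 < onePoint z := by
  rw [onePoint_eq hz]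
  have := mass_pos (2 * z.re)
  positivity

lemma berezin_eq {z w : ℂ} (hz : z ∈ leftHalfPlane) (hw : w ∈ leftHalfPlane) :
    berezin z w = (√(2 * π) * mass (2 * z.re))⁻¹ * (exp (-(z.re - w.re) ^ 2) *
      ‖𝓕 (cutDensity (z.re + w.re)) ((z.im - w.im) / (2 * π))‖ ^ 2) := by
  rw [berezin, norm_kernel_sq hz hw, onePoint_eq hz]
  have h := (mass_pos (2 * z.re)).ne'
  have h1 : (2 * π) = √(2 * π) * √(2 * π) := (mul_self_sqrt (by positivity)).symm
  have h2 : √(2 * π) ≠ 0 := by positivity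
  nth_rewrite 1 [h1]
  field_simp

/-! ### Absolute convergence of the Cauchy integral -/

lemma intervalIntegrable_inv_sqrt_abs :
    IntervalIntegrable (fun v : ℝ => (√|v|)⁻¹) volume (-1) 1 := by
  have h1 : IntervalIntegrable (fun v : ℝ => (√|v|)⁻¹) volume 0 1 := by
    refine (intervalIntegral.intervalIntegrable_rpow' (a := 0) (b := 1) (r := -(1 / 2))
      (by norm_num)).congr ?_
    intro v hv
    rw [uIoc_of_le zero_le_one] at hv
    simp only
    rw [rpow_neg hv.1.le, ← sqrt_eq_rpow, abs_of_pos hv.1]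
  have h2 : IntervalIntegrable (fun v : ℝ => (√|v|)⁻¹) volume (-1) 0 := by
    have := (IntervalIntegrable.iff_comp_neg).1 h1
    simpa using this.symm
  exact h2.trans h1

lemma integrable_mul_inv_sqrt_abs {f : ℝ → ℝ} (hf : Integrable f) {C : ℝ}
    (h0 : ∀ v, 0 ≤ f v) (hC : ∀ v, f v ≤ C) : Integrable fun v => f v * (√|v|)⁻¹ := by
  have hI : Integrable ((Ioc (-1 : ℝ) 1).indicator fun v => C * (√|v|)⁻¹) := by
    rw [integrable_indicator_iff measurableSet_Ioc]
    exact ((intervalIntegrable_iff_integrableOn_Ioc_of_le (by norm_num)).1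
      intervalIntegrable_inv_sqrt_abs).const_mul C
  refine (hf.add hI).mono' (hf.aestronglyMeasurable.mul (by fun_prop)) (ae_of_all _ fun v => ?_)
  have hv := h0 v
  rw [Real.norm_of_nonneg (mul_nonneg hv (by positivity)), Pi.add_apply]
  by_cases h : v ∈ Ioc (-1 : ℝ) 1
  · rw [indicator_of_mem h]
    have := mul_le_mul_of_nonneg_right (hC v) (inv_nonneg.2 (sqrt_nonneg |v|))
    linarith
  · rw [indicator_of_notMem h, add_zero]
    refine mul_le_of_le_one_right hv (inv_le_one_of_one_le₀ (Real.one_le_sqrt.2 ?_))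
    by_contra! h'
    exact h ⟨(abs_lt.1 h').1, (abs_lt.1 h').2.le⟩

/-- From |a||b| ≤ a² + b². It dominates the planar singularity by a product of two integrable
one-dimensional ones, so the majorant factorizes. -/
lemma sqrt_abs_mul_sqrt_abs_le_norm (a b : ℝ) :
    √|a| * √|b| ≤ ‖(a + b * Complex.I : ℂ)‖ := by
  rw [← sqrt_mul (abs_nonneg _), ← Real.sqrt_sq (norm_nonneg _), ← Complex.normSq_eq_norm_sq,
    Complex.normSq_apply]
  refine sqrt_le_sqrt ?_
  simp only [Complex.add_re, Complex.ofReal_re, Complex.mul_re, Complex.I_re, mul_zero,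
    Complex.ofReal_im, Complex.I_im, mul_one, sub_self, add_zero, Complex.add_im, Complex.mul_im,
    zero_add]
  nlinarith [sq_nonneg (|a| - |b|), sq_abs a, sq_abs b, abs_nonneg a, abs_nonneg b]

/-- The Cauchy integrand at `x + i y`, up to normalization, in real coordinates. -/
def cauchyIntegrand (x y : ℝ) (p : ℝ × ℝ) : ℂ :=
  ((exp (-(x - p.1) ^ 2) * ‖𝓕 (cutDensity (x + p.1)) ((y - p.2) / (2 * π))‖ ^ 2 : ℝ) : ℂ) /
    (((x - p.1 : ℝ) : ℂ) + ((y - p.2 : ℝ) : ℂ) * Complex.I)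

lemma measurable_fourier_cutDensity :
    Measurable fun p : ℝ × ℝ => 𝓕 (cutDensity p.1) p.2 := by
  simp only [fourier_cutDensity]
  have h1 : Measurable fun q : (ℝ × ℝ) × ℝ => density q.1.1 q.2 :=
    Measurable.comp (g := fun p : ℝ × ℝ => density p.1 p.2)
      (f := fun q : (ℝ × ℝ) × ℝ => (q.1.1, q.2)) measurable_density
      (Continuous.measurable (by fun_prop))
  have h2 : Continuous fun q : (ℝ × ℝ) × ℝ =>
      Complex.exp (-(2 * π * (q.1.2 : ℂ) * Complex.I) * (q.2 : ℂ)) := by fun_prop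
  have h3 : Measurable fun q : (ℝ × ℝ) × ℝ =>
      Complex.exp (-(2 * π * (q.1.2 : ℂ) * Complex.I) * (q.2 : ℂ)) * (density q.1.1 q.2 : ℂ) :=
    h2.measurable.mul (Complex.measurable_ofReal.comp h1)
  exact (h3.stronglyMeasurable.integral_prod_right' (ν := volume.restrict (Iio 0))).measurable

lemma measurable_cauchyIntegrand (x y : ℝ) : Measurable (cauchyIntegrand x y) := by
  have h : Measurable fun p : ℝ × ℝ => 𝓕 (cutDensity (x + p.1)) ((y - p.2) / (2 * π)) :=
    Measurable.comp (g := fun p : ℝ × ℝ => 𝓕 (cutDensity p.1) p.2)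
      (f := fun p : ℝ × ℝ => (x + p.1, (y - p.2) / (2 * π))) measurable_fourier_cutDensity
      (Continuous.measurable (by fun_prop))
  have h1 : Measurable fun p : ℝ × ℝ => exp (-(x - p.1) ^ 2) := by fun_prop
  have h2 : Measurable fun p : ℝ × ℝ =>
      ((x - p.1 : ℝ) : ℂ) + ((y - p.2 : ℝ) : ℂ) * Complex.I :=
    Continuous.measurable (by fun_prop)
  exact (Complex.measurable_ofReal.comp (h1.mul (h.norm.pow_const 2))).div h2

lemma integrable_cauchyIntegrand (x y : ℝ) :
    Integrable (cauchyIntegrand x y) (volume.prod volume) := by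
  obtain ⟨C, hC⟩ := exists_normSq_fourier_cutDensity_le
  have hC0 : 0 ≤ C := by simpa using (sq_nonneg _).trans (hC 0 0)
  have i1 : Integrable fun a : ℝ => exp (-a ^ 2) * (√|a|)⁻¹ := by
    refine integrable_mul_inv_sqrt_abs (C := 1) ?_ (fun v => (exp_pos _).le) fun v => ?_
    · simpa using integrable_exp_neg_mul_sq (b := 1) one_pos
    · exact exp_le_one_iff.2 (by nlinarith [sq_nonneg v])
  have i2 : Integrable fun v : ℝ => C * (1 + (v / (2 * π)) ^ 2)⁻¹ * (√|v|)⁻¹ := by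
    refine integrable_mul_inv_sqrt_abs (C := C) ?_ (fun v => by positivity) fun v => ?_
    · exact (integrable_inv_one_add_sq.comp_div (R := 2 * π) (by positivity)).const_mul C
    · exact mul_le_of_le_one_right hC0 (inv_le_one_of_one_le₀ (by nlinarith [sq_nonneg (v / (2 * π))]))
  refine ((i1.comp_sub_left x).mul_prod (i2.comp_sub_left y)).mono'
    (measurable_cauchyIntegrand x y).aestronglyMeasurable ?_
  have hx : ∀ᵐ u : ℝ, u ≠ x := by simp [ae_iff]
  have hy : ∀ᵐ v : ℝ, v ≠ y := by simp [ae_iff]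
  filter_upwards [Measure.quasiMeasurePreserving_fst.ae hx,
    Measure.quasiMeasurePreserving_snd.ae hy] with p hpx hpy
  have h1 : 0 < √|x - p.1| := sqrt_pos.2 (abs_pos.2 (sub_ne_zero.2 hpx.symm))
  have h2 : 0 < √|y - p.2| := sqrt_pos.2 (abs_pos.2 (sub_ne_zero.2 hpy.symm))
  rw [cauchyIntegrand, norm_div, Complex.norm_real, Real.norm_of_nonneg (by positivity),
    div_eq_mul_inv]
  calc _ ≤ (exp (-(x - p.1) ^ 2) * (C * (1 + ((y - p.2) / (2 * π)) ^ 2)⁻¹)) *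
        (√|x - p.1| * √|y - p.2|)⁻¹ := by
        gcongr
        · exact hC _ _
        · exact sqrt_abs_mul_sqrt_abs_le_norm _ _
    _ = _ := by rw [mul_inv]; ring

/-! ### Evaluation of the Cauchy transform -/

lemma integral_cauchyIntegrand_right {x u : ℝ} (y : ℝ) (hxu : x - u ≠ 0) :
    ∫ v, cauchyIntegrand x y (u, v) = ((2 * π * ∫ r in Iio (0 : ℝ),
      density (2 * u) r * (cumul (2 * x) r - if x < u then mass (2 * x) else 0) : ℝ) : ℂ) := by
  set q : ℝ → ℂ := fun v => ((‖𝓕 (cutDensity (x + u)) (v / (2 * π))‖ ^ 2 : ℝ) : ℂ) /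
    (((x - u : ℝ) : ℂ) + (v : ℂ) * Complex.I) with hq
  have h1 : ∀ v, cauchyIntegrand x y (u, v) = (exp (-(x - u) ^ 2) : ℂ) * q (y - v) := fun v => by
    simp only [cauchyIntegrand, hq]; push_cast; ring
  have h2 := Measure.integral_comp_mul_left q (2 * π)
  have h3 : ∀ ξ : ℝ, q (2 * π * ξ) = ((‖𝓕 (cutDensity (x + u)) ξ‖ ^ 2 : ℝ) : ℂ) /
      ((x - u : ℝ) + 2 * π * ξ * Complex.I) := fun ξ => by
    simp only [hq]
    rw [mul_div_cancel_left₀ _ (by positivity)]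
    push_cast; rfl
  simp only [h1]
  rw [integral_const_mul, integral_sub_left_eq_self q volume y]
  have hpi : (0 : ℝ) < 2 * π := by positivity
  have h4 : ∫ v, q v = ((2 * π : ℝ) : ℂ) * ∫ ξ, q (2 * π * ξ) := by
    rw [h2, abs_of_pos (inv_pos.2 hpi), Complex.real_smul, ← mul_assoc, ← Complex.ofReal_mul,
      mul_inv_cancel₀ hpi.ne', Complex.ofReal_one, one_mul]
  rw [h4]
  simp only [h3]
  rw [mul_left_comm, exp_mul_integral_normSq_fourier_div hxu, ← Complex.ofReal_mul]

lemma integral_cauchyIntegrand {x : ℝ} (hx : x < 0) (y : ℝ) :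
    ∫ p in Iio (0 : ℝ) ×ˢ univ, cauchyIntegrand x y p
      = ((2 * π * (-(√(2 * π) / 2 * firstMoment (2 * x))
          - mass (2 * x) * ∫ u in x..0, mass (2 * u)) : ℝ) : ℂ) := by
  rw [Measure.volume_eq_prod, setIntegral_prod _ (integrable_cauchyIntegrand x y).integrableOn,
    ← integral_density_mul_cumul_sub x hx, ← integral_const_mul, ← integral_complex_ofReal]
  have hne : ∀ᵐ u : ℝ, u ≠ x := by simp [ae_iff]
  refine integral_congr_ae ?_
  filter_upwards [ae_restrict_of_ae hne] with u hu
  rw [Measure.restrict_univ]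
  exact integral_cauchyIntegrand_right y (sub_ne_zero.2 hu.symm)

lemma measurableSet_leftHalfPlane : MeasurableSet leftHalfPlane :=
  measurableSet_lt Complex.measurable_re measurable_const

lemma isOpen_leftHalfPlane : IsOpen leftHalfPlane :=
  isOpen_lt Complex.continuous_re continuous_const

lemma berezin_div_eq {z w : ℂ} (hz : z ∈ leftHalfPlane) (hw : w ∈ leftHalfPlane) :
    (berezin z w : ℂ) / (z - w) = (((√(2 * π) * mass (2 * z.re))⁻¹ : ℝ) : ℂ) *
      cauchyIntegrand z.re z.im (w.re, w.im) := by
  have e : z - w = ((z.re - w.re : ℝ) : ℂ) + ((z.im - w.im : ℝ) : ℂ) * Complex.I := by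
    apply Complex.ext <;> simp
  rw [berezin_eq hz hw, e, cauchyIntegrand, Complex.ofReal_mul, mul_div_assoc]

lemma preimage_equivRealProd_symm_leftHalfPlane :
    Complex.measurableEquivRealProd.symm ⁻¹' leftHalfPlane = Iio (0 : ℝ) ×ˢ univ := by
  ext p; simp [leftHalfPlane, Complex.measurableEquivRealProd_symm_apply]

lemma integrableOn_berezin_div {z : ℂ} (hz : z ∈ leftHalfPlane) :
    IntegrableOn (fun w : ℂ => (berezin z w : ℂ) / (z - w)) leftHalfPlane area := by
  unfold area
  rw [IntegrableOn, Measure.restrict_smul]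
  refine Integrable.smul_measure ?_ ENNReal.ofReal_ne_top
  rw [← IntegrableOn, integrableOn_congr_fun (fun w hw => berezin_div_eq hz hw) measurableSet_leftHalfPlane]
  refine Integrable.integrableOn (Integrable.const_mul ?_ _)
  have := (Complex.volume_preserving_equiv_real_prod.integrable_comp_emb
    Complex.measurableEquivRealProd.measurableEmbedding
    (g := cauchyIntegrand z.re z.im)).2 (integrable_cauchyIntegrand z.re z.im)
  exact this

lemma cauchyTransform_eq {z : ℂ} (hz : z ∈ leftHalfPlane) :
    cauchyTransform z = ((-(firstMoment (2 * z.re) / mass (2 * z.re))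
      - 2 / √(2 * π) * ∫ u in z.re..0, mass (2 * u) : ℝ) : ℂ) := by
  have hmp := Complex.volume_preserving_equiv_real_prod.symm.setIntegral_preimage_emb
    Complex.measurableEquivRealProd.symm.measurableEmbedding
    (fun w : ℂ => cauchyIntegrand z.re z.im (w.re, w.im)) leftHalfPlane
  rw [preimage_equivRealProd_symm_leftHalfPlane] at hmp
  have hI : ∫ w in leftHalfPlane, cauchyIntegrand z.re z.im (w.re, w.im) = _ :=
    hmp.symm.trans (integral_cauchyIntegrand hz z.im)
  rw [cauchyTransform, area, Measure.restrict_smul, integral_smul_measure,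
    setIntegral_congr_fun measurableSet_leftHalfPlane fun w hw => berezin_div_eq hz hw,
    integral_const_mul, hI, ENNReal.toReal_ofReal (by positivity), Complex.real_smul,
    ← Complex.ofReal_mul, ← Complex.ofReal_mul]
  congr 1
  have h := (mass_pos (2 * z.re)).ne'
  have h2 : √(2 * π) ≠ 0 := by positivity
  field_simp

lemma cauchyTransform_eq_baseMGF {z : ℂ} (hz : z ∈ leftHalfPlane) :
    cauchyTransform z = ((-(deriv baseMGF (2 * z.re) / baseMGF (2 * z.re))
      - 2 / √(2 * π) * ∫ u in z.re..0, mass (2 * u) : ℝ) : ℂ) := by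
  rw [cauchyTransform_eq hz, firstMoment_eq_deriv_baseMGF, mass_eq_baseMGF (2 * z.re),
    mul_div_mul_left _ _ (exp_pos _).ne']

/-! ### Differentiation and Ward's equation -/

lemma hasFDerivAt_ofReal_comp_re {φ : ℝ → ℝ} {φ' : ℝ} {z : ℂ} (h : HasDerivAt φ φ' z.re) :
    HasFDerivAt (𝕜 := ℝ) (fun w : ℂ => (φ w.re : ℂ))
      (Complex.ofRealCLM.comp (φ' • Complex.reCLM)) z :=
  Complex.ofRealCLM.hasFDerivAt.comp z (h.comp_hasFDerivAt z Complex.reCLM.hasFDerivAt)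

lemma delbar_eq_of_eventuallyEq {f : ℂ → ℂ} {φ : ℝ → ℝ} {φ' : ℝ} {z : ℂ}
    (hf : f =ᶠ[𝓝 z] fun w => (φ w.re : ℂ)) (h : HasDerivAt φ φ' z.re) :
    delbar f z = ((φ' / 2 : ℝ) : ℂ) := by
  rw [delbar, hf.fderiv_eq, (hasFDerivAt_ofReal_comp_re h).fderiv]
  simp; ring

lemma del_eq_of_eventuallyEq {f : ℂ → ℂ} {φ : ℝ → ℝ} {φ' : ℝ} {z : ℂ}
    (hf : f =ᶠ[𝓝 z] fun w => (φ w.re : ℂ)) (h : HasDerivAt φ φ' z.re) :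
    del f z = ((φ' / 2 : ℝ) : ℂ) := by
  rw [del, hf.fderiv_eq, (hasFDerivAt_ofReal_comp_re h).fderiv]
  simp; ring

/-- The logarithmic derivative of the base moment generating function. -/
def logDerivMGF (s : ℝ) : ℝ := deriv baseMGF s / baseMGF s

lemma contDiff_logDerivMGF : ContDiff ℝ ∞ logDerivMGF :=
  (contDiff_infty_iff_deriv.1 contDiff_baseMGF).2.div contDiff_baseMGF fun s => (baseMGF_pos s).ne'

lemma hasDerivAt_logDerivMGF (s : ℝ) : HasDerivAt logDerivMGF (deriv logDerivMGF s) s :=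
  (contDiff_logDerivMGF.differentiable (by simp) s).hasDerivAt

/-- The Cauchy transform along the negative real axis. -/
def realCauchy (x : ℝ) : ℝ :=
  -logDerivMGF (2 * x) - 2 / √(2 * π) * ∫ u in x..0, mass (2 * u)

lemma continuous_mass_two_mul : Continuous fun u => mass (2 * u) :=
  contDiff_mass.continuous.comp (by fun_prop)

lemma hasDerivAt_integral_mass (x : ℝ) :
    HasDerivAt (fun x => ∫ u in x..0, mass (2 * u)) (-mass (2 * x)) x :=
  intervalIntegral.integral_hasDerivAt_left (continuous_mass_two_mul.intervalIntegrable _ _)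
    continuous_mass_two_mul.stronglyMeasurable.stronglyMeasurableAtFilter
    continuous_mass_two_mul.continuousAt

lemma contDiff_realCauchy : ContDiff ℝ ∞ realCauchy := by
  have h2 : ContDiff ℝ ∞ fun x : ℝ => 2 * x := by fun_prop
  have hI : ContDiff ℝ ∞ fun x => ∫ u in x..0, mass (2 * u) := by
    rw [contDiff_infty_iff_deriv]
    refine ⟨fun x => (hasDerivAt_integral_mass x).differentiableAt, ?_⟩
    rw [show deriv (fun x => ∫ u in x..0, mass (2 * u)) = fun x => -mass (2 * x) from
      funext fun x => (hasDerivAt_integral_mass x).deriv]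
    exact (contDiff_mass.comp h2).neg
  exact (contDiff_logDerivMGF.comp h2).neg.sub (contDiff_const.mul hI)

lemma hasDerivAt_realCauchy (x : ℝ) : HasDerivAt realCauchy
    (2 * ((√(2 * π))⁻¹ * mass (2 * x) - deriv logDerivMGF (2 * x))) x := by
  have h := ((hasDerivAt_logDerivMGF (2 * x)).comp x ((hasDerivAt_id x).const_mul 2)).neg.sub
    ((hasDerivAt_integral_mass x).const_mul (2 / √(2 * π)))
  refine h.congr_deriv ?_
  rw [div_eq_mul_inv]; ring

/-- The Gaussian factor relating `mass` to `baseMGF` contributes -4x here; its further derivative is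
what produces the constant -1 in `lap_log_onePoint`. -/
lemma hasDerivAt_log_mass (x : ℝ) :
    HasDerivAt (fun x => log ((√(2 * π))⁻¹ * mass (2 * x)))
      (2 * (logDerivMGF (2 * x) - 2 * x)) x := by
  have e : (fun x => log ((√(2 * π))⁻¹ * mass (2 * x)))
      = fun x => log (√(2 * π))⁻¹ + (-(2 * x) ^ 2 / 2 + log (baseMGF (2 * x))) := by
    ext x
    have h := (baseMGF_pos (2 * x)).ne'
    rw [mass_eq_baseMGF, log_mul (by positivity) (by positivity), log_mul (exp_pos _).ne' h, log_exp]
  rw [e]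
  have h2 : HasDerivAt (fun x : ℝ => 2 * x) 2 x := by
    simpa using (hasDerivAt_id x).const_mul 2
  have h1 : HasDerivAt baseMGF (deriv baseMGF (2 * x)) (2 * x) :=
    (contDiff_baseMGF.differentiable (by simp) _).hasDerivAt
  have h3 := (h1.comp x h2).log (baseMGF_pos (2 * x)).ne'
  have h4 := (((h2.pow 2).neg.div_const 2).add h3).const_add (log (√(2 * π))⁻¹)
  refine h4.congr_deriv ?_
  simp only [logDerivMGF, Function.comp]
  push_cast
  ring

lemma cauchyTransform_eq_realCauchy {z : ℂ} (hz : z ∈ leftHalfPlane) :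
    cauchyTransform z = (realCauchy z.re : ℂ) :=
  cauchyTransform_eq_baseMGF hz

lemma delbar_cauchyTransform {z : ℂ} (hz : z ∈ leftHalfPlane) :
    delbar cauchyTransform z
      = (((√(2 * π))⁻¹ * mass (2 * z.re) - deriv logDerivMGF (2 * z.re) : ℝ) : ℂ) := by
  have hev : cauchyTransform =ᶠ[𝓝 z] fun w => (realCauchy w.re : ℂ) := by
    filter_upwards [isOpen_leftHalfPlane.mem_nhds hz] with w hw
    exact cauchyTransform_eq_realCauchy hw
  rw [delbar_eq_of_eventuallyEq hev (hasDerivAt_realCauchy z.re)]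
  congr 1; ring

lemma lap_log_onePoint {z : ℂ} (hz : z ∈ leftHalfPlane) :
    lap (fun w : ℂ => ((log (onePoint w) : ℝ) : ℂ)) z
      = ((deriv logDerivMGF (2 * z.re) - 1 : ℝ) : ℂ) := by
  have hlog : ∀ w ∈ leftHalfPlane, (fun w : ℂ => ((log (onePoint w) : ℝ) : ℂ)) =ᶠ[𝓝 w]
      fun w => ((log ((√(2 * π))⁻¹ * mass (2 * w.re)) : ℝ) : ℂ) := by
    intro w hw
    filter_upwards [isOpen_leftHalfPlane.mem_nhds hw] with v hv
    rw [onePoint_eq hv]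
  -- The formula is needed on a neighbourhood of z, not only at z, because `del` is applied to it
  -- next.
  have hbar : delbar (fun w : ℂ => ((log (onePoint w) : ℝ) : ℂ)) =ᶠ[𝓝 z]
      fun w => ((logDerivMGF (2 * w.re) - 2 * w.re : ℝ) : ℂ) := by
    filter_upwards [isOpen_leftHalfPlane.mem_nhds hz] with w hw
    rw [delbar_eq_of_eventuallyEq (φ := fun x => log ((√(2 * π))⁻¹ * mass (2 * x))) (hlog w hw)
      (hasDerivAt_log_mass w.re)]
    congr 1; ring
  have h2 : HasDerivAt (fun x : ℝ => 2 * x) 2 z.re := by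
    simpa using (hasDerivAt_id z.re).const_mul 2
  have hd := ((hasDerivAt_logDerivMGF (2 * z.re)).comp z.re h2).sub h2
  rw [lap, del_eq_of_eventuallyEq (φ := fun x => logDerivMGF (2 * x) - 2 * x) hbar hd]
  congr 1; ring

lemma contDiffOn_onePoint : ContDiffOn ℝ ∞ onePoint leftHalfPlane := by
  have h2 : ContDiff ℝ ∞ fun z : ℂ => 2 * z.re := contDiff_const.mul Complex.reCLM.contDiff
  exact (contDiff_const.mul (contDiff_mass.comp h2)).contDiffOn.congr fun z hz => onePoint_eq hz

lemma contDiffOn_cauchyTransform : ContDiffOn ℝ ∞ cauchyTransform leftHalfPlane := by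
  have h : ContDiff ℝ ∞ fun z : ℂ => (realCauchy z.re : ℂ) :=
    Complex.ofRealCLM.contDiff.comp (contDiff_realCauchy.comp Complex.reCLM.contDiff)
  exact h.contDiffOn.congr fun z hz => cauchyTransform_eq_realCauchy hz

lemma ward_equation {z : ℂ} (hz : z ∈ leftHalfPlane) :
    delbar cauchyTransform z
      = (onePoint z : ℂ) - 1 - lap (fun w : ℂ => ((log (onePoint w) : ℝ) : ℂ)) z := by
  rw [delbar_cauchyTransform hz, lap_log_onePoint hz, onePoint_eq hz]
  push_cast; ring

end HardEdge

end

theorem theorem6p2 :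
    -- The one-point function is real, positive and smooth on the left half-plane.
    (∀ z ∈ HardEdge.leftHalfPlane,
      HardEdge.kernel z z = (HardEdge.onePoint z : ℂ) ∧ 0 < HardEdge.onePoint z) ∧
    ContDiffOn ℝ ∞ HardEdge.onePoint HardEdge.leftHalfPlane ∧
    -- The integral defining the Cauchy transform converges and defines a smooth function.
    (∀ z ∈ HardEdge.leftHalfPlane,
      IntegrableOn (fun w : ℂ => (HardEdge.berezin z w : ℂ) / (z - w))
        HardEdge.leftHalfPlane HardEdge.area) ∧
    ContDiffOn ℝ ∞ HardEdge.cauchyTransform HardEdge.leftHalfPlane ∧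
    -- Ward's equation holds pointwise.
    (∀ z ∈ HardEdge.leftHalfPlane,
      HardEdge.delbar HardEdge.cauchyTransform z =
        (HardEdge.onePoint z : ℂ) - 1 -
          HardEdge.lap (fun w : ℂ => ((Real.log (HardEdge.onePoint w) : ℝ) : ℂ)) z) := by
  exact ⟨fun z hz => ⟨by rw [HardEdge.kernel_self hz, HardEdge.onePoint_eq hz],
      HardEdge.onePoint_pos hz⟩, HardEdge.contDiffOn_onePoint,
    fun z hz => HardEdge.integrableOn_berezin_div hz, HardEdge.contDiffOn_cauchyTransform,
    fun z hz => HardEdge.ward_equation hz⟩
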